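/- All vector spaces are finite-dimensional and real. A symplectic vector space is a vector space with a nondegenerate alternating bilinear form $\omega$; $\overline{X}$ denotes $X$ with the form $-\omega$, products carry the sum of the forms, and $W^\perp$ denotes the symplectic orthogonal of a subspace $W$. For a symplectic vector space $X$, let $\mathcal{L}(X)$ be the set of Lagrangian subspaces ($L=L^\perp$) with its usual topology (as a subspace of the Grassmannian), with the metric $d(L,L')=\dim L/(L\cap L')$, and let $\mathcal{L}_\bullet(X)=\mathcal{L}(X)\times\mathbb{Z}_{\ge 0}$. For $(L,k)\in\mathcal{L}_\bullet(X)$ put $$S(L,k)=\{(L',j)\in\mathcal{L}_\bullet(X) : d(L,L')\le k-j\},$$ and $S(\mathcal{A})=\bigcup_{a\in \mathcal{A}}S(a)$ for $\mathcal{A}\subseteq\mathcal{L}_\bullet(X)$. The *Sabot topology* on $\mathcal{L}_\bullet(X)$ is the topology generated by the sets $S(\mathcal{U}\times\{k\})$ with $k\ge 0$ and $\mathcal{U}\subseteq\mathcal{L}(X)$ open. Let $X$, $Y$, $Z$ be symplectic vector spaces. For $(f,k)\in\mathcal{L}_\bullet(X\times\overline{Y})$ and $(g,l)\in\mathcal{L}_\bullet(Y\times\overline{Z})$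 the *indexed composition* is $$(f,k)(g,l)=\bigl(fg,\;k+l+\mathcal{E}^C(f\times g)\bigr)\in\mathcal{L}_\bullet(X\times\overline{Z}),$$ where $fg=\{(x,z) : \exists\, y\in Y,\ (x,y)\in f,\ (y,z)\in g\}$, $C=X\times\Delta_Y\times\overline{Z}\subseteq X\times\overline{Y}\times Y\times\overline{Z}$ with $\Delta_Y=\{(y,y):y\in Y\}$, and $\mathcal{E}^C(f\times g)=\dim\bigl((f\times g)\cap C^\perp\bigr)$. **Theorem.** The indexed composition $$\mathcal{L}_\bullet(X\times\overline{Y})\times\mathcal{L}_\bullet(Y\times\overline{Z})\to\mathcal{L}_\bullet(X\times\overline{Z})$$ is continuous, where each $\mathcal{L}_\bullet$ carries its Sabot topology and the left-hand side the product of the two Sabot topologies. -/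

import Mathlib

/-- A linear symplectic structure on a real vector space: an alternating, nondegenerate
bilinear form. -/
structure SymplecticForm (X : Type*) [AddCommGroup X] [Module ℝ X] where
  form : LinearMap.BilinForm ℝ X
  alt : form.IsAlt
  nondegenerate : form.Nondegenerate

namespace SymplecticForm

variable {X Y Z : Type*} [AddCommGroup X] [Module ℝ X] [AddCommGroup Y] [Module ℝ Y]
  [AddCommGroup Z] [Module ℝ Z]

/-- The dual structure `X̄`: the same vector space, with the form multiplied by `-1`. -/
def dual (ω : SymplecticForm X) : SymplecticForm X where
  form := -ω.form
  alt x := by simp [ω.alt.self_eq_zero x]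
  nondegenerate :=
    ⟨fun x h => ω.nondegenerate.1 x fun y => by simpa using h y,
      fun y h => ω.nondegenerate.2 y fun x => by simpa using h x⟩

/-- The product structure on `X × Y`:
`ω ((x, y), (x', y')) = ω_X (x, x') + ω_Y (y, y')`. -/
def prod (ωX : SymplecticForm X) (ωY : SymplecticForm Y) : SymplecticForm (X × Y) where
  form := ωX.form.compl₁₂ (LinearMap.fst ℝ X Y) (LinearMap.fst ℝ X Y) +
    ωY.form.compl₁₂ (LinearMap.snd ℝ X Y) (LinearMap.snd ℝ X Y)
  alt p := by simp [ωX.alt.self_eq_zero p.1, ωY.alt.self_eq_zero p.2]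
  nondegenerate :=
    ⟨fun p h => Prod.ext
        (ωX.nondegenerate.1 p.1 fun x => by simpa using h (x, 0))
        (ωY.nondegenerate.1 p.2 fun y => by simpa using h (0, y)),
      fun p h => Prod.ext
        (ωX.nondegenerate.2 p.1 fun x => by simpa using h (x, 0))
        (ωY.nondegenerate.2 p.2 fun y => by simpa using h (0, y))⟩

theorem dual_apply (ω : SymplecticForm X) (x x' : X) :
    ω.dual.form x x' = -ω.form x x' := rfl

theorem prod_apply (ωX : SymplecticForm X) (ωY : SymplecticForm Y) (p q : X × Y) :
    (ωX.prod ωY).form p q = ωX.form p.1 q.1 + ωY.form p.2 q.2 := rfl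

/-- The symplectic orthogonal `W^⊥`. -/
def orth (ω : SymplecticForm X) (W : Submodule ℝ X) : Submodule ℝ X :=
  ω.form.orthogonal W

theorem mem_orth (ω : SymplecticForm X) (W : Submodule ℝ X) (x : X) :
    x ∈ ω.orth W ↔ ∀ w ∈ W, ω.form w x = 0 := Iff.rfl

/-- A subspace is Lagrangian if it is equal to its symplectic orthogonal. -/
def IsLagrangian (ω : SymplecticForm X) (L : Submodule ℝ X) : Prop :=
  ω.orth L = L

/-- The excess `dim (L ∩ C^⊥)` of `L` relative to a coisotropic subspace `C`. -/
noncomputable def excess (ω : SymplecticForm X) (C L : Submodule ℝ X) : ℕ :=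
  Module.finrank ℝ ↥(L ⊓ ω.orth C)

theorem orth_inf [FiniteDimensional ℝ X] (ω : SymplecticForm X) (A B : Submodule ℝ X) :
    ω.orth (A ⊓ B) = ω.orth A ⊔ ω.orth B := by
  have hoo : ∀ W, ω.orth (ω.orth W) = W := fun W =>
    LinearMap.BilinForm.orthogonal_orthogonal ω.nondegenerate ω.alt.isRefl W
  have hle : ∀ {U W : Submodule ℝ X}, U ≤ W → ω.orth W ≤ ω.orth U := fun h =>
    LinearMap.BilinForm.orthogonal_le h
  apply le_antisymm
  · rw [← hoo (ω.orth A ⊔ ω.orth B)]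
    apply hle
    apply le_inf
    · conv_rhs => rw [← hoo A]
      exact hle le_sup_left
    · conv_rhs => rw [← hoo B]
      exact hle le_sup_right
  · exact sup_le (hle inf_le_left) (hle inf_le_right)

end SymplecticForm

/-- The usual topology on the set of all linear subspaces of a finite-dimensional real vector
space (the disjoint union of the Grassmannians): a set of subspaces is open iff, for every `k`,
the set of linearly independent `k`-frames whose span lies in it is open in the space of
linearly independent `k`-frames. Here `X` carries its module topology, which is its unique
Hausdorff vector space topology. -/
@[reducible] noncomputable def grassmannianTopology (X : Type*) [AddCommGroup X] [Module ℝ X] :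
    TopologicalSpace (Submodule ℝ X) :=
  letI : TopologicalSpace X := moduleTopology ℝ X
  ⨆ k : ℕ, TopologicalSpace.coinduced
    (fun v : {v : Fin k → X // LinearIndependent ℝ v} => Submodule.span ℝ (Set.range v.1))
    inferInstance

section Grassmannian

variable {X : Type*} [AddCommGroup X] [Module ℝ X]

/-- The Lagrangian Grassmannian `𝓛(X)`: the set of Lagrangian subspaces of `X`. -/
def LagrangianGrassmannian (ω : SymplecticForm X) : Type _ :=
  {L : Submodule ℝ X // ω.IsLagrangian L}

/-- The usual topology of the Lagrangian Grassmannian, as a subspace of the Grassmannian. -/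
noncomputable instance (ω : SymplecticForm X) : TopologicalSpace (LagrangianGrassmannian ω) :=
  (grassmannianTopology X).induced Subtype.val

/-- The metric `d(L, L')`, the codimension of `L ∩ L'` in `L`. -/
noncomputable def lagrangianDist {ω : SymplecticForm X} (L L' : LagrangianGrassmannian ω) : ℕ :=
  Module.finrank ℝ (L.1 ⧸ (L.1 ⊓ L'.1).submoduleOf L.1)

/-- The indexed Lagrangian Grassmannian `𝓛_•(X) = 𝓛(X) × ℕ`, whose elements are the indexed
Lagrangian subspaces `(L, k)`. (It does not carry the product topology; see below.) -/
@[ext] structure IndexedLagrangian (ω : SymplecticForm X) where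
  space : LagrangianGrassmannian ω
  index : ℕ

namespace IndexedLagrangian

variable {ω : SymplecticForm X}

/-- The sublevel `S(L, k) = {(L', j) | d(L, L') ≤ k - j}` of a point. -/
def sublevel (a : IndexedLagrangian ω) : Set (IndexedLagrangian ω) :=
  {b | (lagrangianDist a.space b.space : ℤ) ≤ (a.index : ℤ) - (b.index : ℤ)}

/-- The sublevel `S(𝓤 × {k})` of a subset `𝓤 × {k}` of the level `𝓛_k(X) = 𝓛(X) × {k}`. -/
def sublevelSet (U : Set (LagrangianGrassmannian ω)) (k : ℕ) : Set (IndexedLagrangian ω) :=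
  ⋃ L ∈ U, sublevel ⟨L, k⟩

/-- The Sabot topology on `𝓛_•(X)`, generated by the sublevels of the open subsets of the
levels. -/
instance sabotTopology : TopologicalSpace (IndexedLagrangian ω) :=
  TopologicalSpace.generateFrom
    {s | ∃ (U : Set (LagrangianGrassmannian ω)) (k : ℕ), IsOpen U ∧ s = sublevelSet U k}

end IndexedLagrangian

end Grassmannian

section Composition

variable {X Y Z : Type*} [AddCommGroup X] [Module ℝ X] [AddCommGroup Y] [Module ℝ Y]
  [AddCommGroup Z] [Module ℝ Z]

/-- The set-theoretic composition `{(x, z) | ∃ y, (x, y) ∈ f ∧ (y, z) ∈ g}` of linear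
relations. -/
def linRelComp (f : Submodule ℝ (X × Y)) (g : Submodule ℝ (Y × Z)) : Submodule ℝ (X × Z) where
  carrier := {p | ∃ y, (p.1, y) ∈ f ∧ (y, p.2) ∈ g}
  zero_mem' := ⟨0, f.zero_mem, g.zero_mem⟩
  add_mem' := by
    rintro p q ⟨y, hy, hy'⟩ ⟨u, hu, hu'⟩
    exact ⟨y + u, f.add_mem hy hu, g.add_mem hy' hu'⟩
  smul_mem' := by
    rintro c p ⟨y, hy, hy'⟩
    exact ⟨c • y, f.smul_mem c hy, g.smul_mem c hy'⟩

theorem mem_linRelComp {f : Submodule ℝ (X × Y)} {g : Submodule ℝ (Y × Z)} {p : X × Z} :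
    p ∈ linRelComp f g ↔ ∃ y, (p.1, y) ∈ f ∧ (y, p.2) ∈ g := Iff.rfl

/-- The (coisotropic) subspace `X × Δ_Y × Z̄` of `X × Ȳ × Y × Z̄`. -/
def diagonalCoisotropic (X Y Z : Type*) [AddCommGroup X] [Module ℝ X] [AddCommGroup Y]
    [Module ℝ Y] [AddCommGroup Z] [Module ℝ Z] : Submodule ℝ ((X × Y) × (Y × Z)) where
  carrier := {w | w.1.2 = w.2.1}
  zero_mem' := rfl
  add_mem' := fun {a b} (ha : a.1.2 = a.2.1) (hb : b.1.2 = b.2.1) => by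
    change a.1.2 + b.1.2 = a.2.1 + b.2.1
    rw [ha, hb]
  smul_mem' := fun c a (ha : a.1.2 = a.2.1) => by
    change c • a.1.2 = c • a.2.1
    rw [ha]

theorem mem_orth_diagonalCoisotropic (ωX : SymplecticForm X) (ωY : SymplecticForm Y)
    (ωZ : SymplecticForm Z) (w : (X × Y) × (Y × Z)) :
    w ∈ ((ωX.prod ωY.dual).prod (ωY.prod ωZ.dual)).orth (diagonalCoisotropic X Y Z) ↔
      w.1.1 = 0 ∧ w.1.2 = w.2.1 ∧ w.2.2 = 0 := by
  simp only [SymplecticForm.mem_orth, SymplecticForm.prod_apply, SymplecticForm.dual_apply]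
  constructor
  · intro h
    refine ⟨ωX.nondegenerate.2 _ fun x => ?_, ?_, ωZ.nondegenerate.2 _ fun z => ?_⟩
    · simpa using h ((x, 0), (0, 0)) rfl
    · refine (sub_eq_zero.1 (ωY.nondegenerate.2 _ fun y => ?_)).symm
      have := h ((0, y), (y, 0)) rfl
      simp only [map_zero, LinearMap.zero_apply] at this
      rw [map_sub]
      linarith
    · simpa using h ((0, 0), (0, z)) rfl
  · rintro ⟨h1, h2, h3⟩ n (hn : n.1.2 = n.2.1)
    simp [h1, h2, h3, hn]

/-- The composition of two linear canonical relations is a linear canonical relation. -/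
theorem isLagrangian_linRelComp [FiniteDimensional ℝ X] [FiniteDimensional ℝ Y]
    [FiniteDimensional ℝ Z] {ωX : SymplecticForm X} {ωY : SymplecticForm Y}
    {ωZ : SymplecticForm Z} {f : Submodule ℝ (X × Y)} {g : Submodule ℝ (Y × Z)}
    (hf : (ωX.prod ωY.dual).IsLagrangian f) (hg : (ωY.prod ωZ.dual).IsLagrangian g) :
    (ωX.prod ωZ.dual).IsLagrangian (linRelComp f g) := by
  have hff : ∀ a ∈ f, ∀ b ∈ f, ωX.form a.1 b.1 + -ωY.form a.2 b.2 = 0 := fun a ha b hb =>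
    (((ωX.prod ωY.dual).mem_orth f b).1 (hf.symm ▸ hb)) a ha
  have hgg : ∀ a ∈ g, ∀ b ∈ g, ωY.form a.1 b.1 + -ωZ.form a.2 b.2 = 0 := fun a ha b hb =>
    (((ωY.prod ωZ.dual).mem_orth g b).1 (hg.symm ▸ hb)) a ha
  apply le_antisymm
  · intro p hp
    set Ω := (ωX.prod ωY.dual).prod (ωY.prod ωZ.dual) with hΩ
    have hw : (((p.1, 0), (0, p.2)) : (X × Y) × (Y × Z)) ∈
        Ω.orth (f.prod g ⊓ diagonalCoisotropic X Y Z) := by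
      rw [SymplecticForm.mem_orth]
      rintro n ⟨⟨hn1, hn2⟩, (hn3 : n.1.2 = n.2.1)⟩
      have := ((ωX.prod ωZ.dual).mem_orth _ _).1 hp (n.1.1, n.2.2)
        ⟨n.1.2, hn1, by rw [hn3]; exact hn2⟩
      simpa [hΩ, SymplecticForm.prod_apply, SymplecticForm.dual_apply] using this
    rw [SymplecticForm.orth_inf, Submodule.mem_sup] at hw
    obtain ⟨l, hl, c, hc, hlc⟩ := hw
    rw [mem_orth_diagonalCoisotropic] at hc
    obtain ⟨hc1, hc2, hc3⟩ := hc
    have hl' := (Ω.mem_orth _ _).1 hl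
    have hl1 : l.1 ∈ f := by
      rw [← hf]
      intro n hn
      simpa [hΩ, SymplecticForm.prod_apply] using hl' (n, 0) ⟨hn, g.zero_mem⟩
    have hl2 : l.2 ∈ g := by
      rw [← hg]
      intro n hn
      simpa [hΩ, SymplecticForm.prod_apply] using hl' (0, n) ⟨f.zero_mem, hn⟩
    have e1 : l.1.1 + c.1.1 = p.1 := congrArg (fun w => w.1.1) hlc
    have e2 : l.1.2 + c.1.2 = 0 := congrArg (fun w => w.1.2) hlc
    have e3 : l.2.1 + c.2.1 = 0 := congrArg (fun w => w.2.1) hlc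
    have e4 : l.2.2 + c.2.2 = p.2 := congrArg (fun w => w.2.2) hlc
    rw [hc1, add_zero] at e1
    rw [hc3, add_zero] at e4
    have e5 : l.1.2 = l.2.1 := by
      rw [eq_neg_of_add_eq_zero_left e2, eq_neg_of_add_eq_zero_left e3, hc2]
    refine ⟨l.1.2, ?_, ?_⟩
    · rw [← e1]; exact hl1
    · rw [← e4, e5]; exact hl2
  · rintro p ⟨y, hy, hy'⟩
    rw [SymplecticForm.mem_orth]
    rintro q ⟨u, hu, hu'⟩
    have h1 := hff _ hu _ hy
    have h2 := hgg _ hu' _ hy'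
    simp only [SymplecticForm.prod_apply, SymplecticForm.dual_apply]
    linarith

variable [FiniteDimensional ℝ X] [FiniteDimensional ℝ Y] [FiniteDimensional ℝ Z]
  {ωX : SymplecticForm X} {ωY : SymplecticForm Y} {ωZ : SymplecticForm Z}

/-- The indexed composition
`(f', k') (f'', k'') = (f' f'', k' + k'' + 𝓔^C (f' × f''))`, where `C = X × Δ_Y × Z̄`, of an
indexed canonical relation to `X` from `Y` with one to `Y` from `Z`. -/
noncomputable def IndexedLagrangian.comp (a : IndexedLagrangian (ωX.prod ωY.dual))
    (b : IndexedLagrangian (ωY.prod ωZ.dual)) : IndexedLagrangian (ωX.prod ωZ.dual) where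
  space := ⟨linRelComp a.space.1 b.space.1, isLagrangian_linRelComp a.space.2 b.space.2⟩
  index := a.index + b.index +
    ((ωX.prod ωY.dual).prod (ωY.prod ωZ.dual)).excess (diagonalCoisotropic X Y Z)
      (a.space.1.prod b.space.1)

end Composition

open Filter Topology Module SymplecticForm

/-! ### Orthogonals and dimensions of Lagrangian subspaces -/

namespace SymplecticForm

section

variable {X : Type*} [AddCommGroup X] [Module ℝ X]

/-! Two facts carry the proof, and both are dimension counts resting on `dim fg + E(f × g) = dim ((f
× g) ∩ C)`, where `E` is the excess.

Monotonicity (`comp_mem_sublevel`): composition maps `S(a) × S(b)` into `S(ab)`.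

Continuity along levels (`LagrangianGrassmannian.exists_nhds_comp`): `fg` may jump when `f`, `g` are
perturbed, but near any `L` there is an `L'` with `d(L', f'g') + E(f' × g') ≤ d(L, fg) + E(f × g)`.
To find it, lift `Q = L ∩ fg` to composable pairs in `f × g`. The composable pairs of `f' × g'` are
close to a subspace of the old ones, so the part of `Q` lifting into that subspace moves slightly
into `f'g'`. Its image is isotropic, hence extends to a Lagrangian `L'` near `L`; the dimension lost
is at most the drop of `dim ((f × g) ∩ C)`, which is the drop of the excess because `dim fg = dim
f'g'`.

If `(f, k)(g, l)` lies in `S(U × {m})`, the second fact keeps `(f', k)(g', l)` in that set for `f'`,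
`g'` near `f`, `g`; the first fact and the triangle inequality extend this to everything below these
points. -/

theorem finrank_add_finrank_orth [FiniteDimensional ℝ X] (ω : SymplecticForm X) (W : Submodule ℝ X) :
    finrank ℝ W + finrank ℝ (ω.orth W) = finrank ℝ X := by
  have h := LinearMap.BilinForm.finrank_orthogonal ω.nondegenerate W
  have := W.finrank_le
  unfold orth
  omega

theorem orth_anti (ω : SymplecticForm X) {U W : Submodule ℝ X} (h : U ≤ W) :
    ω.orth W ≤ ω.orth U :=
  LinearMap.BilinForm.orthogonal_le h

theorem IsLagrangian.two_mul_finrank [FiniteDimensional ℝ X] {ω : SymplecticForm X} {L : Submodule ℝ X}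
    (h : ω.IsLagrangian L) : 2 * finrank ℝ L = finrank ℝ X := by
  have h1 := ω.finrank_add_finrank_orth L
  rw [show ω.orth L = L from h] at h1
  omega

/-- The form is isotropic on a Lagrangian subspace. -/
theorem IsLagrangian.form_eq_zero {ω : SymplecticForm X} {L : Submodule ℝ X}
    (h : ω.IsLagrangian L) {x y : X} (hx : x ∈ L) (hy : y ∈ L) : ω.form x y = 0 :=
  (ω.mem_orth L y).1 (show y ∈ ω.orth L from h.symm ▸ hy) x hx

theorem IsLagrangian.prod {Y : Type*} [AddCommGroup Y] [Module ℝ Y]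
    {ωX : SymplecticForm X} {ωY : SymplecticForm Y} {f : Submodule ℝ X} {g : Submodule ℝ Y}
    (hf : ωX.IsLagrangian f) (hg : ωY.IsLagrangian g) :
    (ωX.prod ωY).IsLagrangian (f.prod g) := by
  apply le_antisymm
  · intro p hp
    rw [mem_orth] at hp
    constructor
    · rw [SetLike.mem_coe, ← show ωX.orth f = f from hf]
      intro x hx
      simpa [prod_apply] using hp (x, 0) ⟨hx, g.zero_mem⟩
    · rw [SetLike.mem_coe, ← show ωY.orth g = g from hg]
      intro y hy
      simpa [prod_apply] using hp (0, y) ⟨f.zero_mem, hy⟩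
  · rintro p ⟨hp, hp'⟩
    rw [mem_orth]
    rintro q ⟨hq, hq'⟩
    rw [prod_apply, hf.form_eq_zero hq hp, hg.form_eq_zero hq' hp', add_zero]

end

end SymplecticForm

/-! ### Dimension formulas and the distance -/

section

variable {X : Type*} [AddCommGroup X] [Module ℝ X] [FiniteDimensional ℝ X]

theorem Submodule.finrank_prod {Y : Type*} [AddCommGroup Y] [Module ℝ Y]
    [FiniteDimensional ℝ Y] (f : Submodule ℝ X) (g : Submodule ℝ Y) :
    finrank ℝ (f.prod g) = finrank ℝ f + finrank ℝ g := by
  have h : LinearMap.range (f.subtype.prodMap g.subtype) = f.prod g := by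
    rw [LinearMap.range_prodMap, f.range_subtype, g.range_subtype]
  rw [← h, LinearMap.finrank_range_of_inj
    (Function.Injective.prodMap f.injective_subtype g.injective_subtype), Module.finrank_prod]

theorem Submodule.finrank_map_add_finrank_ker_inf {Y : Type*} [AddCommGroup Y] [Module ℝ Y]
    (f : X →ₗ[ℝ] Y) (A : Submodule ℝ X) :
    finrank ℝ (A.map f) + finrank ℝ ↥(A ⊓ LinearMap.ker f) = finrank ℝ A := by
  rw [← (f.domRestrict A).finrank_range_add_finrank_ker, LinearMap.range_domRestrict,
    LinearMap.ker_domRestrict, ← Submodule.finrank_map_subtype_eq, Submodule.map_comap_subtype]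

theorem lagrangianDist_add_finrank_inf {ω : SymplecticForm X}
    (L L' : LagrangianGrassmannian ω) :
    lagrangianDist L L' + finrank ℝ ↥(L.1 ⊓ L'.1) = finrank ℝ L.1 := by
  rw [← ((L.1 ⊓ L'.1).submoduleOf L.1).finrank_quotient_add_finrank,
    (Submodule.submoduleOfEquivOfLe (inf_le_left : L.1 ⊓ L'.1 ≤ L.1)).finrank_eq]
  rfl

/-- `L ∩ M` and `M ∩ N` both lie in `M`, and they meet inside `L ∩ N`. -/
theorem lagrangianDist_triangle {ω : SymplecticForm X} (L M N : LagrangianGrassmannian ω) :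
    lagrangianDist L N ≤ lagrangianDist L M + lagrangianDist M N := by
  have h1 := lagrangianDist_add_finrank_inf L M
  have h2 := lagrangianDist_add_finrank_inf M N
  have h3 := lagrangianDist_add_finrank_inf L N
  have h4 := Submodule.finrank_sup_add_finrank_inf_eq (L.1 ⊓ M.1) (M.1 ⊓ N.1)
  have h5 : finrank ℝ ↥(L.1 ⊓ M.1 ⊔ M.1 ⊓ N.1) ≤ finrank ℝ M.1 :=
    Submodule.finrank_mono (sup_le inf_le_right inf_le_left)
  have h6 : finrank ℝ ↥(L.1 ⊓ M.1 ⊓ (M.1 ⊓ N.1)) ≤ finrank ℝ ↥(L.1 ⊓ N.1) :=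
    Submodule.finrank_mono (inf_le_inf inf_le_left inf_le_right)
  omega

end

/-! ### Monotonicity of the indexed composition -/

section Composition

variable {X Y Z : Type*} [AddCommGroup X] [Module ℝ X] [AddCommGroup Y] [Module ℝ Y]
  [AddCommGroup Z] [Module ℝ Z]

/-- The projection `((x, y), (y', z)) ↦ (x, z)`. -/
def outerProj (X Y Z : Type*) [AddCommGroup X] [Module ℝ X] [AddCommGroup Y] [Module ℝ Y]
    [AddCommGroup Z] [Module ℝ Z] : (X × Y) × (Y × Z) →ₗ[ℝ] X × Z :=
  (LinearMap.fst ℝ X Y).prodMap (LinearMap.snd ℝ Y Z)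

theorem map_outerProj_prod_inf_diagonal (f : Submodule ℝ (X × Y)) (g : Submodule ℝ (Y × Z)) :
    (f.prod g ⊓ diagonalCoisotropic X Y Z).map (outerProj X Y Z) = linRelComp f g := by
  ext p
  constructor
  · rintro ⟨w, ⟨⟨hf, hg⟩, hw : w.1.2 = w.2.1⟩, rfl⟩
    exact ⟨w.1.2, hf, by rw [hw]; exact hg⟩
  · rintro ⟨y, hf, hg⟩
    exact ⟨((p.1, y), (y, p.2)), ⟨⟨hf, hg⟩, rfl⟩, rfl⟩

variable [FiniteDimensional ℝ X] [FiniteDimensional ℝ Y] [FiniteDimensional ℝ Z]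

/-- Rank-nullity for the outer projection of a subspace of `C = X × Δ_Y × Z̄`; the kernel lies in
`C^⊥`. -/
theorem finrank_map_outerProj_add (ωX : SymplecticForm X) (ωY : SymplecticForm Y)
    (ωZ : SymplecticForm Z) (A : Submodule ℝ ((X × Y) × (Y × Z))) :
    finrank ℝ ((A ⊓ diagonalCoisotropic X Y Z).map (outerProj X Y Z)) +
      ((ωX.prod ωY.dual).prod (ωY.prod ωZ.dual)).excess (diagonalCoisotropic X Y Z) A =
      finrank ℝ ↥(A ⊓ diagonalCoisotropic X Y Z) := by
  have h : A ⊓ ((ωX.prod ωY.dual).prod (ωY.prod ωZ.dual)).orth (diagonalCoisotropic X Y Z) =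
      A ⊓ diagonalCoisotropic X Y Z ⊓ LinearMap.ker (outerProj X Y Z) := by
    ext w
    rw [Submodule.mem_inf, Submodule.mem_inf, Submodule.mem_inf, mem_orth_diagonalCoisotropic,
      LinearMap.mem_ker]
    constructor
    · rintro ⟨hA, h1, h2, h3⟩
      exact ⟨⟨hA, h2⟩, Prod.ext h1 h3⟩
    · rintro ⟨⟨hA, h2⟩, h⟩
      exact ⟨hA, congrArg Prod.fst h, h2, congrArg Prod.snd h⟩
  rw [← Submodule.finrank_map_add_finrank_ker_inf (outerProj X Y Z) (A ⊓ _),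
    SymplecticForm.excess, h]

theorem finrank_linRelComp_add_excess (ωX : SymplecticForm X) (ωY : SymplecticForm Y)
    (ωZ : SymplecticForm Z) (f : Submodule ℝ (X × Y)) (g : Submodule ℝ (Y × Z)) :
    finrank ℝ (linRelComp f g) +
      ((ωX.prod ωY.dual).prod (ωY.prod ωZ.dual)).excess (diagonalCoisotropic X Y Z) (f.prod g) =
      finrank ℝ ↥(f.prod g ⊓ diagonalCoisotropic X Y Z) := by
  rw [← map_outerProj_prod_inf_diagonal, finrank_map_outerProj_add]

variable {ωX : SymplecticForm X} {ωY : SymplecticForm Y} {ωZ : SymplecticForm Z}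

namespace IndexedLagrangian

/-- Indexed composition is monotone: it maps sublevels into sublevels. -/
theorem comp_mem_sublevel {a a' : IndexedLagrangian (ωX.prod ωY.dual)}
    {b b' : IndexedLagrangian (ωY.prod ωZ.dual)} (ha : a' ∈ a.sublevel) (hb : b' ∈ b.sublevel) :
    a'.comp b' ∈ (a.comp b).sublevel := by
  set Ω := (ωX.prod ωY.dual).prod (ωY.prod ωZ.dual) with hΩ
  set C := diagonalCoisotropic X Y Z with hC
  have hL₁ := a.space.2.prod b.space.2
  have hL₂ := a'.space.2.prod b'.space.2
  set L₁ := a.space.1.prod b.space.1 with hL₁_def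
  set L₂ := a'.space.1.prod b'.space.1 with hL₂_def
  have hinf : L₁ ⊓ L₂ = (a.space.1 ⊓ a'.space.1).prod (b.space.1 ⊓ b'.space.1) := by
    rw [hL₁_def, hL₂_def, Submodule.prod_inf_prod]
  -- Duality turns the codimension of `L₁ ∩ L₂ ∩ C` in `L₁ ∩ C` into `d(L₁, L₂) + E(L₁) - dim ((L₁ ∩
  -- L₂)^⊥ ∩ C^⊥)`, with `d(L₁, L₂)` the sum of the distances of the factors.
  have key : ∀ A, finrank ℝ ↥(A ⊓ C) + finrank ℝ ↥(Ω.orth A ⊔ Ω.orth C) =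
      finrank ℝ ((X × Y) × (Y × Z)) := fun A => by
    rw [← orth_inf, finrank_add_finrank_orth]
  have k₁ := key L₁
  have k₂ := key (L₁ ⊓ L₂)
  rw [show Ω.orth L₁ = L₁ from hL₁] at k₁
  have s₁ := Submodule.finrank_sup_add_finrank_inf_eq L₁ (Ω.orth C)
  have s₂ := Submodule.finrank_sup_add_finrank_inf_eq (Ω.orth (L₁ ⊓ L₂)) (Ω.orth C)
  have s₃ := Submodule.finrank_sup_add_finrank_inf_eq (L₁ ⊓ Ω.orth C) (L₂ ⊓ Ω.orth C)
  -- `(L₁ ∩ L₂)^⊥` contains both Lagrangians, so its intersection with `C^⊥` has dimension at least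
  -- `E(L₁) + E(L₂) - E(L₁ ∩ L₂)`.
  have m₁ : finrank ℝ ↥(L₁ ⊓ Ω.orth C ⊔ L₂ ⊓ Ω.orth C) ≤
      finrank ℝ ↥(Ω.orth (L₁ ⊓ L₂) ⊓ Ω.orth C) := by
    refine Submodule.finrank_mono (sup_le (inf_le_inf_right _ ?_) (inf_le_inf_right _ ?_))
    · exact (show Ω.orth L₁ = L₁ from hL₁).symm.trans_le (Ω.orth_anti inf_le_left)
    · exact (show Ω.orth L₂ = L₂ from hL₂).symm.trans_le (Ω.orth_anti inf_le_right)
  have m₂ : finrank ℝ ↥(L₁ ⊓ Ω.orth C ⊓ (L₂ ⊓ Ω.orth C)) ≤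
      finrank ℝ ↥(L₁ ⊓ L₂ ⊓ Ω.orth C) :=
    Submodule.finrank_mono (le_inf (inf_le_inf inf_le_left inf_le_left)
      (inf_le_left.trans inf_le_right))
  -- The count yields `d(L₁, L₂) - E(L₁) - E(L₂) + 2 E(L₁ ∩ L₂)` as a bound on the distance of the
  -- composites; this inequality reduces it to `d(L₁, L₂) + E(L₁) - E(L₂)`.
  have m₃ : finrank ℝ ↥(L₁ ⊓ L₂ ⊓ Ω.orth C) ≤ finrank ℝ ↥(L₁ ⊓ Ω.orth C) :=
    Submodule.finrank_mono (inf_le_inf_right _ inf_le_left)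
  have o₁ := Ω.finrank_add_finrank_orth (L₁ ⊓ L₂)
  have l₁ := hL₁.two_mul_finrank
  have d₁ := lagrangianDist_add_finrank_inf a.space a'.space
  have d₂ := lagrangianDist_add_finrank_inf b.space b'.space
  have d₃ := lagrangianDist_add_finrank_inf (a.comp b).space (a'.comp b').space
  have p₁ : finrank ℝ ↥(L₁ ⊓ L₂) = finrank ℝ ↥(a.space.1 ⊓ a'.space.1) +
      finrank ℝ ↥(b.space.1 ⊓ b'.space.1) := by rw [hinf, Submodule.finrank_prod]
  have p₂ : finrank ℝ L₁ = finrank ℝ a.space.1 + finrank ℝ b.space.1 :=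
    Submodule.finrank_prod _ _
  have c₁ := finrank_linRelComp_add_excess ωX ωY ωZ a.space.1 b.space.1
  have c₂ := finrank_linRelComp_add_excess ωX ωY ωZ (a.space.1 ⊓ a'.space.1)
    (b.space.1 ⊓ b'.space.1)
  rw [← hinf] at c₂
  have c₃ : finrank ℝ (linRelComp (a.space.1 ⊓ a'.space.1) (b.space.1 ⊓ b'.space.1)) ≤
      finrank ℝ ↥((a.comp b).space.1 ⊓ (a'.comp b').space.1) := by
    refine Submodule.finrank_mono ?_
    rintro p ⟨y, hf, hg⟩
    exact ⟨⟨y, hf.1, hg.1⟩, ⟨y, hf.2, hg.2⟩⟩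
  have i₁ : (a.comp b).index = a.index + b.index + Ω.excess C L₁ := rfl
  have i₂ : (a'.comp b').index = a'.index + b'.index + Ω.excess C L₂ := rfl
  have n₁ : (a.comp b).space.1 = linRelComp a.space.1 b.space.1 := rfl
  have e₁ : Ω.excess C L₁ = finrank ℝ ↥(L₁ ⊓ Ω.orth C) := rfl
  have e₂ : Ω.excess C L₂ = finrank ℝ ↥(L₂ ⊓ Ω.orth C) := rfl
  have e₃ : Ω.excess C (L₁ ⊓ L₂) = finrank ℝ ↥(L₁ ⊓ L₂ ⊓ Ω.orth C) := rfl
  simp only [sublevel, Set.mem_ofPred_eq] at ha hb ⊢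
  rw [n₁] at d₃ c₃
  rw [← hΩ, ← hC, ← hL₁_def] at c₁
  rw [← hΩ, ← hC] at c₂
  omega

end IndexedLagrangian

end Composition

/-! ### The Grassmannian topology through ranges of linear maps -/

section

variable {W : Type*} [NormedAddCommGroup W] [NormedSpace ℝ W] [FiniteDimensional ℝ W]

theorem isOpen_grassmannianTopology_iff {s : Set (Submodule ℝ W)} :
    IsOpen[grassmannianTopology W] s ↔ ∀ k : ℕ,
      IsOpen {v : Fin k → W | LinearIndependent ℝ v ∧ Submodule.span ℝ (Set.range v) ∈ s} := by
  have : IsModuleTopology ℝ W := isModuleTopologyOfFiniteDimensional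
  unfold grassmannianTopology
  rw [← eq_moduleTopology ℝ W]
  simp only [isOpen_iSup_iff, isOpen_coinduced]
  refine forall_congr' fun k => ?_
  have ho : IsOpen {v : Fin k → W | LinearIndependent ℝ v} := isOpen_setOfPred_linearIndependent
  rw [ho.isOpenEmbedding_subtypeVal.isOpen_iff_image_isOpen]
  congr! 1
  ext v
  constructor
  · rintro ⟨w, hw, rfl⟩
    exact ⟨w.2, hw⟩
  · rintro ⟨h, h'⟩
    exact ⟨⟨v, h⟩, h', rfl⟩

variable {V : Type*} [NormedAddCommGroup V] [NormedSpace ℝ V] [FiniteDimensional ℝ V]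

/-- The range of an injective linear map depends continuously on the map. -/
theorem tendsto_range_grassmannian {e : V →L[ℝ] W} (he : Function.Injective e) :
    Tendsto (fun e' : V →L[ℝ] W => LinearMap.range (e' : V →ₗ[ℝ] W)) (𝓝 e)
      (@nhds _ (grassmannianTopology W) (LinearMap.range (e : V →ₗ[ℝ] W))) := by
  let _ := grassmannianTopology W
  let b := Module.finBasis ℝ V
  have hr : ∀ e' : V →L[ℝ] W, Submodule.span ℝ (Set.range fun i => e' (b i)) =
      LinearMap.range (e' : V →ₗ[ℝ] W) := fun e' => by
    rw [LinearMap.range_eq_map, ← b.span_eq, Submodule.map_span, ← Set.range_comp]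
    rfl
  have hli : ∀ e' : V →L[ℝ] W, Function.Injective e' → LinearIndependent ℝ fun i => e' (b i) :=
    fun e' h => b.linearIndependent.map' (e' : V →ₗ[ℝ] W) (LinearMap.ker_eq_bot.2 h)
  rw [tendsto_nhds]
  intro s hs hes
  have hc : Continuous fun (e' : V →L[ℝ] W) i => e' (b i) := by fun_prop
  have := (isOpen_grassmannianTopology_iff.1 hs _).preimage hc
  filter_upwards [this.mem_nhds ⟨hli e he, (hr e).symm ▸ hes⟩] with e' he'
  rw [Set.mem_preimage, ← hr e']
  exact he'.2

/-- Taking ranges is an open map to the Grassmannian. -/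
theorem image_range_mem_nhds_grassmannian (e : V →L[ℝ] W) {N : Set (V →L[ℝ] W)} (hN : N ∈ 𝓝 e) :
    (fun e' : V →L[ℝ] W => LinearMap.range (e' : V →ₗ[ℝ] W)) '' N ∈
      @nhds _ (grassmannianTopology W) (LinearMap.range (e : V →ₗ[ℝ] W)) := by
  let _ := grassmannianTopology W
  obtain ⟨O, hON, hO, heO⟩ := mem_nhds_iff.1 hN
  refine mem_of_superset ?_ (Set.image_mono hON)
  refine IsOpen.mem_nhds ?_ (Set.mem_image_of_mem _ heO)
  rw [isOpen_grassmannianTopology_iff]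
  intro k
  rw [isOpen_iff_mem_nhds]
  rintro v ⟨hv, e', he', hr⟩
  let T : (Fin k → W) → (Fin k → ℝ) →ₗ[ℝ] W := fun w => Fintype.linearCombination ℝ w
  have hT : ∀ w, LinearMap.range (T w) = Submodule.span ℝ (Set.range w) := fun w =>
    Fintype.range_linearCombination ℝ w
  have hinj : Function.Injective (T v) := hv.fintypeLinearCombination_injective
  have hr' : LinearMap.range (e' : V →ₗ[ℝ] W) = LinearMap.range (T v) := hr.trans (hT v).symm
  let i := LinearEquiv.ofInjective (T v) hinj
  -- Factor `e' = T v ∘ g` with `g` surjective. Keeping `g` and moving the frame to `w` gives a map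
  -- near `e'` with range the span of `w`; no injectivity of `e'` is needed.
  let g : V →ₗ[ℝ] (Fin k → ℝ) := i.symm.toLinearMap ∘ₗ
    (e' : V →ₗ[ℝ] W).codRestrict (LinearMap.range (T v)) fun x => hr' ▸ LinearMap.mem_range_self _ x
  have hg : ∀ x, T v (g x) = e' x := fun x =>
    congrArg Subtype.val (i.apply_symm_apply _)
  have hgs : LinearMap.range g = ⊤ := by
    rw [LinearMap.range_eq_top]
    intro c
    obtain ⟨x, hx⟩ : T v c ∈ LinearMap.range (e' : V →ₗ[ℝ] W) := hr' ▸ LinearMap.mem_range_self _ c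
    exact ⟨x, hinj ((hg x).trans hx)⟩
  let Φ : (Fin k → W) → V →L[ℝ] W := fun w =>
    ∑ j, ((LinearMap.proj j ∘ₗ g).toContinuousLinearMap).smulRight (w j)
  have hΦ : ∀ w, (Φ w : V →ₗ[ℝ] W) = T w ∘ₗ g := fun w => by
    ext x
    simp [Φ, T, Fintype.linearCombination_apply]
  have hΦc : Continuous Φ := by
    refine continuous_finsetSum _ fun j _ => ?_
    exact (ContinuousLinearMap.smulRightL ℝ V W _).continuous.comp (continuous_apply j)
  have hΦv : Φ v = e' := ContinuousLinearMap.coe_injective (by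
    rw [hΦ]
    exact LinearMap.ext hg)
  have h1 : Φ ⁻¹' O ∈ 𝓝 v := (hO.preimage hΦc).mem_nhds (by rwa [Set.mem_preimage, hΦv])
  have h2 : {w : Fin k → W | LinearIndependent ℝ w} ∈ 𝓝 v :=
    isOpen_setOfPred_linearIndependent.mem_nhds hv
  filter_upwards [h1, h2] with w hw hw'
  refine ⟨hw', Φ w, hw, ?_⟩
  change LinearMap.range (Φ w : V →ₗ[ℝ] W) = _
  rw [hΦ, LinearMap.range_comp_of_range_eq_top _ hgs, hT]

end

/-! ### Lagrangians near a given one, in Darboux coordinates -/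

section

variable {V : Type*} [NormedAddCommGroup V] [InnerProductSpace ℝ V] [FiniteDimensional ℝ V]

open scoped InnerProductSpace

/-- Riesz representation of a linear family of functionals. -/
theorem exists_linearMap_inner_eq {E : Type*} [AddCommGroup E] [Module ℝ E]
    (B : E →ₗ[ℝ] V →ₗ[ℝ] ℝ) : ∃ r : E →ₗ[ℝ] V, ∀ x v, ⟪v, r x⟫_ℝ = B x v := by
  let b := stdOrthonormalBasis ℝ V
  refine ⟨∑ i, (B.flip (b i)).smulRight (b i), fun x v => ?_⟩
  conv_rhs => rw [← b.sum_repr' v]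
  simp [inner_sum, inner_smul_right, real_inner_comm, mul_comm]

/-- A linear map that is symmetric on a subspace `R` agrees on `R` with a symmetric map of
controlled norm. -/
theorem exists_symmetric_extension (β : V →L[ℝ] V) (R : Submodule ℝ V)
    (h : ∀ r ∈ R, ∀ r' ∈ R, ⟪r, β r'⟫_ℝ = ⟪β r, r'⟫_ℝ) :
    ∃ s : V →L[ℝ] V, (∀ u v, ⟪s u, v⟫_ℝ = ⟪u, s v⟫_ℝ) ∧ ‖s‖ ≤ 3 * ‖β‖ ∧
      ∀ r ∈ R, s r = β r := by
  set p := R.starProjection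
  have hp : ∀ u v, ⟪p u, v⟫_ℝ = ⟪u, p v⟫_ℝ := R.inner_starProjection_left_eq_right
  have hpR : ∀ v, p v ∈ R := fun v => R.starProjection_apply_mem v
  have hpr : ∀ r ∈ R, p r = r := fun r hr => Submodule.starProjection_eq_self_iff.2 hr
  have hp1 : ‖p‖ ≤ 1 := R.starProjection_norm_le
  set γ := ContinuousLinearMap.adjoint β
  have hγ : ‖γ‖ = ‖β‖ := LinearIsometryEquiv.norm_map _ _
  have hγl : ∀ u v, ⟪γ u, v⟫_ℝ = ⟪u, β v⟫_ℝ := fun u v =>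
    ContinuousLinearMap.adjoint_inner_left β v u
  have hγr : ∀ u v, ⟪u, γ v⟫_ℝ = ⟪β u, v⟫_ℝ := fun u v =>
    ContinuousLinearMap.adjoint_inner_right β u v
  -- Symmetry on `R` makes `pβp` symmetric and gives `pγ = pβ` on `R`. Each of the three terms has
  -- norm at most `‖β‖`, whence the factor 3.
  refine ⟨β * p + p * γ - p * β * p, fun u v => ?_, ?_, fun r hr => ?_⟩
  · simp only [sub_apply, add_apply,
      mul_apply_eq_comp, inner_sub_left, inner_add_left, inner_sub_right,
      inner_add_right]
    rw [hp, hγl, ← hp u (γ v), hγr, hp (β (p u)) v, ← hp u (β (p v)),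
      h _ (hpR u) _ (hpR v)]
    ring
  · have h1 : ‖β * p‖ ≤ ‖β‖ :=
      (norm_mul_le _ _).trans (mul_le_of_le_one_right (norm_nonneg _) hp1)
    have h2 : ‖p * γ‖ ≤ ‖β‖ :=
      (norm_mul_le _ _).trans ((mul_le_of_le_one_left (norm_nonneg _) hp1).trans hγ.le)
    have h3 : ‖p * β * p‖ ≤ ‖β‖ := by
      rw [mul_assoc]
      exact (norm_mul_le _ _).trans ((mul_le_of_le_one_left (norm_nonneg _) hp1).trans h1)
    have := norm_sub_le (β * p + p * γ) (p * β * p)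
    have := norm_add_le (β * p) (p * γ)
    linarith
  · have h1 : p (γ r) = p (β r) := by
      refine ext_inner_left ℝ fun v => ?_
      rw [← hp, ← hp, hγr, h _ (hpR v) r hr]
    simp [hpr r hr, h1]

/-- A parametrization `e` of a Lagrangian subspace extends to Darboux coordinates: there is a
complementary Lagrangian embedding `κ`, with coordinate projections `πa` and `πb`. -/
theorem SymplecticForm.exists_darboux_coordinates {W : Type*} [AddCommGroup W] [Module ℝ W]
    [FiniteDimensional ℝ W] (ω : SymplecticForm W) {e : V →ₗ[ℝ] W} (he : Function.Injective e)
    (hL : ω.IsLagrangian (LinearMap.range e)) :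
    ∃ (κ : V →ₗ[ℝ] W) (πa πb : W →ₗ[ℝ] V), (∀ w, e (πa w) + κ (πb w) = w) ∧
      (∀ u v, πa (e u + κ v) = u) ∧ (∀ u v, πb (e u + κ v) = v) ∧
      ∀ w w', ω.form w w' = ⟪πa w, πb w'⟫_ℝ - ⟪πb w, πa w'⟫_ℝ := by
  have hsk : ∀ w w', ω.form w w' = -ω.form w' w := fun w w' => (ω.alt.neg_eq w' w).symm
  have hee : ∀ u v, ω.form (e u) (e v) = 0 := fun u v =>
    hL.form_eq_zero (LinearMap.mem_range_self e u) (LinearMap.mem_range_self e v)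
  obtain ⟨πb, hπb⟩ := exists_linearMap_inner_eq ((ω.form ∘ₗ e).flip)
  replace hπb : ∀ w v, ⟪v, πb w⟫_ℝ = ω.form (e v) w := hπb
  have hπbe : ∀ u, πb (e u) = 0 := fun u => ext_inner_left ℝ fun v => by
    rw [hπb, hee, inner_zero_right]
  have hsurj : LinearMap.range πb = ⊤ := by
    rw [← Submodule.orthogonal_eq_bot_iff, Submodule.eq_bot_iff]
    intro v hv
    refine he ?_
    rw [map_zero]
    refine ω.nondegenerate.1 _ fun w => ?_
    rw [← hπb, real_inner_comm]
    exact (Submodule.mem_orthogonal _ _).1 hv _ (LinearMap.mem_range_self _ _)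
  obtain ⟨κ₀, hκ₀⟩ := πb.exists_rightInverse_of_surjective hsurj
  replace hκ₀ : ∀ v, πb (κ₀ v) = v := fun v => LinearMap.congr_fun hκ₀ v
  -- The complement `κ₀` need not be isotropic. Adding `e ∘ c` changes the form on it by two equal
  -- terms, each cancelling half, hence the factor `-1/2`.
  obtain ⟨c, hc⟩ := exists_linearMap_inner_eq ((-(1 / 2) : ℝ) • (ω.form.compl₁₂ κ₀ κ₀))
  replace hc : ∀ u v, ⟪v, c u⟫_ℝ = -(1 / 2) * ω.form (κ₀ u) (κ₀ v) := hc
  set κ := κ₀ + e ∘ₗ c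
  have hκ : ∀ v, κ v = κ₀ v + e (c v) := fun v => rfl
  have hπbκ : ∀ v, πb (κ v) = v := fun v => by rw [hκ, map_add, hκ₀, hπbe, add_zero]
  have heκ : ∀ u v, ω.form (e u) (κ v) = ⟪u, v⟫_ℝ := fun u v => by rw [← hπb, hπbκ]
  have hκe : ∀ u v, ω.form (κ u) (e v) = -⟪u, v⟫_ℝ := fun u v => by
    rw [hsk, heκ, real_inner_comm]
  have hκκ : ∀ u v, ω.form (κ u) (κ v) = 0 := fun u v => by
    rw [hκ u, map_add, LinearMap.add_apply, heκ, hκ v, map_add, hsk (κ₀ u) (e (c v)), ← hπb,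
      hκ₀, real_inner_comm v (c u), real_inner_comm u (c v), hc, hc, hsk (κ₀ v)]
    ring
  obtain ⟨πa, hπa⟩ := exists_linearMap_inner_eq (-(ω.form ∘ₗ κ).flip)
  replace hπa : ∀ w v, ⟪v, πa w⟫_ℝ = -ω.form (κ v) w := hπa
  have hdec : ∀ w, e (πa w) + κ (πb w) = w := by
    intro w
    have hmem : w - (e (πa w) + κ (πb w)) ∈ LinearMap.range e := by
      rw [← show ω.orth _ = LinearMap.range e from hL, mem_orth]
      rintro _ ⟨v, rfl⟩
      rw [map_sub, map_add, hee, heκ, hπb, zero_add, sub_self]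
    obtain ⟨v, hv⟩ := hmem
    have hv0 : v = 0 := ext_inner_left ℝ fun u => by
      rw [inner_zero_right, ← neg_eq_zero, ← hκe, hv, map_sub, map_add, hκe, hκκ, hπa]
      ring
    rw [hv0, map_zero] at hv
    exact (sub_eq_zero.1 hv.symm).symm
  refine ⟨κ, πa, πb, hdec, fun u v => ?_, fun u v => ?_, fun w w' => ?_⟩
  · refine ext_inner_left ℝ fun x => ?_
    rw [hπa, map_add, hκe, hκκ, add_zero, neg_neg]
  · rw [map_add, hπbe, hπbκ, zero_add]
  · conv_lhs => rw [← hdec w, ← hdec w']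
    simp only [map_add, LinearMap.add_apply, hee, heκ, hκe, hκκ]
    ring

variable {W : Type*} [NormedAddCommGroup W] [NormedSpace ℝ W] [FiniteDimensional ℝ W]

/-- Let `Q` be a subspace of a Lagrangian `L`. If `j` is close to the inclusion of `Q` and
isotropic on a subspace `Q'` of `Q`, then `j Q'` lies in a Lagrangian close to `L`. The required
closeness of `j` is uniform in `Q'`. -/
theorem eventually_exists_lagrangian_ge {ω : SymplecticForm W} (L : LagrangianGrassmannian ω)
    {U : Set (LagrangianGrassmannian ω)} (hU : U ∈ 𝓝 L) {Q : Submodule ℝ W} (hQ : Q ≤ L.1) :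
    ∀ᶠ j : Q →L[ℝ] W in 𝓝 Q.subtypeL, ∀ Q' : Submodule ℝ Q,
      (∀ x ∈ Q', ∀ y ∈ Q', ω.form (j x) (j y) = 0) →
      ∃ L' ∈ U, Q'.map (j : Q →ₗ[ℝ] W) ≤ L'.1 := by
  let V := EuclideanSpace ℝ (Fin (finrank ℝ L.1))
  let e₀ : V ≃ₗ[ℝ] L.1 := LinearEquiv.ofFinrankEq _ _ (by simp [V])
  let e : V →L[ℝ] W := (L.1.subtype ∘ₗ e₀.toLinearMap).toContinuousLinearMap
  have he : Function.Injective e := L.1.injective_subtype.comp e₀.injective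
  have her : LinearMap.range (e : V →ₗ[ℝ] W) = L.1 := by
    refine (LinearMap.range_comp_of_range_eq_top _ e₀.range).trans L.1.range_subtype
  obtain ⟨κ, πa, πb, hdec, hπa, hπb, hω⟩ := ω.exists_darboux_coordinates (e := (e : V →ₗ[ℝ] W)) he
    (her.symm ▸ L.2)
  -- graphs of small symmetric maps lie in `U`
  obtain ⟨ε, hε, hsmall⟩ : ∃ ε > 0, ∀ s : V →L[ℝ] V, (∀ u v, ⟪s u, v⟫_ℝ = ⟪u, s v⟫_ℝ) →
      ‖s‖ < ε → ∃ L' ∈ U, L'.1 = LinearMap.range ((e : V →ₗ[ℝ] W) + κ ∘ₗ (s : V →ₗ[ℝ] V)) := by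
    obtain ⟨t, ht, htU⟩ := (@mem_nhds_induced _ _ (grassmannianTopology W) _ _ _).1 hU
    have hc : Tendsto (fun s : V →L[ℝ] V => e + κ.toContinuousLinearMap ∘L s) (𝓝 0) (𝓝 e) := by
      have : Continuous fun s : V →L[ℝ] V => e + κ.toContinuousLinearMap ∘L s := by fun_prop
      simpa using this.tendsto 0
    rw [← her] at ht
    obtain ⟨ε, hε, hball⟩ := Metric.mem_nhds_iff.1 (hc ((tendsto_range_grassmannian he) ht))
    refine ⟨ε, hε, fun s hs hsε => ?_⟩
    have hlag : ω.IsLagrangian (LinearMap.range ((e : V →ₗ[ℝ] W) + κ ∘ₗ (s : V →ₗ[ℝ] V))) := by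
      apply le_antisymm
      · intro w hw
        refine ⟨πa w, ?_⟩
        have : s (πa w) = πb w := ext_inner_left ℝ fun v => by
          have := (ω.mem_orth _ _).1 hw _ (LinearMap.mem_range_self _ v)
          rw [hω] at this
          change ⟪πa (e v + κ (s v)), πb w⟫_ℝ - ⟪πb (e v + κ (s v)), πa w⟫_ℝ = 0 at this
          erw [hπa, hπb] at this
          rw [← hs]
          linarith
        change e (πa w) + κ (s (πa w)) = w
        rw [this]
        exact hdec w
      · rintro _ ⟨u, rfl⟩
        rw [mem_orth]
        rintro _ ⟨v, rfl⟩
        change ω.form (e v + κ (s v)) (e u + κ (s u)) = 0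
        rw [hω]
        erw [hπa, hπb, hπa, hπb]
        rw [hs, sub_self]
    exact ⟨⟨_, hlag⟩, htU (hball (by simpa using hsε)), rfl⟩
  have hπL : ∀ w ∈ L.1, e (πa w) = w := by
    intro w hw
    rw [← her] at hw
    obtain ⟨v, rfl⟩ := hw
    have h := hπa v 0
    rw [map_zero, add_zero] at h
    exact congrArg e h
  -- `ρ` serves to extend `j` from `Q` to a perturbation `J j` of the whole parametrization `e`,
  -- chosen before `Q'` is known.
  obtain ⟨ρ, hρ⟩ := LinearMap.exists_leftInverse_of_injective (πa ∘ₗ Q.subtype) (by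
    rw [LinearMap.ker_eq_bot]
    intro q q' h
    apply Subtype.ext
    rw [← hπL q (hQ q.2), ← hπL q' (hQ q'.2)]
    exact congrArg e h)
  let J : (Q →L[ℝ] W) → V →L[ℝ] W := fun j => e + (j - Q.subtypeL) ∘L ρ.toContinuousLinearMap
  have hJc : Continuous J := by fun_prop
  have hJ : ∀ j (q : Q), J j (πa q) = j q := fun j q => by
    change e (πa q) + (j (ρ (πa q)) - (ρ (πa q) : W)) = j q
    rw [show ρ (πa q) = q from LinearMap.congr_fun hρ q, hπL q (hQ q.2), add_sub_cancel]
  have hJe : J Q.subtypeL = e := by simp [J]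
  let A : (Q →L[ℝ] W) → V →L[ℝ] V := fun j => πa.toContinuousLinearMap ∘L J j
  let B : (Q →L[ℝ] W) → V →L[ℝ] V := fun j => πb.toContinuousLinearMap ∘L J j
  have hA : Tendsto A (𝓝 Q.subtypeL) (𝓝 1) := by
    have hc : Continuous A := by fun_prop
    have h1 : A Q.subtypeL = 1 := by
      ext1 v
      change πa (J Q.subtypeL v) = v
      rw [hJe]
      simpa using hπa v 0
    exact h1 ▸ hc.tendsto _
  have hB : Tendsto B (𝓝 Q.subtypeL) (𝓝 0) := by
    have hc : Continuous B := by fun_prop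
    have h1 : B Q.subtypeL = 0 := by
      ext1 v
      change πb (J Q.subtypeL v) = 0
      rw [hJe]
      simpa using hπb v 0
    exact h1 ▸ hc.tendsto _
  have hAu : ∀ᶠ j in 𝓝 Q.subtypeL, IsUnit (A j) :=
    hA.eventually (Units.isOpen.mem_nhds isUnit_one)
  have hβ : Tendsto (fun j => 3 * ‖B j * Ring.inverse (A j)‖) (𝓝 Q.subtypeL) (𝓝 0) := by
    have h1 := (NormedRing.inverse_continuousAt (1 : (V →L[ℝ] V)ˣ)).tendsto.comp hA
    simpa using ((hB.mul h1).norm.const_mul 3)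
  filter_upwards [hAu, hβ.eventually_lt_const hε] with j hju hjε Q' hQ'
  -- The range of `J j` is the graph of `β`. Isotropy of `j Q'` says exactly that `β` is symmetric
  -- on `πa (j Q')`; the graph of a small symmetric map agreeing with `β` there is the required
  -- Lagrangian.
  set β := B j * Ring.inverse (A j)
  have hβA : ∀ q : Q, β (πa (j q)) = πb (j q) := fun q => by
    have h1 : β * A j = B j := by rw [mul_assoc, Ring.inverse_mul_cancel _ hju, mul_one]
    have h2 := DFunLike.congr_fun h1 (πa q)
    change β (πa (J j (πa q))) = πb (J j (πa q)) at h2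
    rwa [hJ] at h2
  obtain ⟨s, hs, hsn, hsβ⟩ := exists_symmetric_extension β
    (Q'.map (πa ∘ₗ (j : Q →ₗ[ℝ] W))) (by
      rintro _ ⟨x, hx, rfl⟩ _ ⟨y, hy, rfl⟩
      change ⟪πa (j x), β (πa (j y))⟫_ℝ = ⟪β (πa (j x)), πa (j y)⟫_ℝ
      rw [hβA, hβA, ← sub_eq_zero, ← hω]
      exact hQ' x hx y hy)
  obtain ⟨L', hL'U, hL'⟩ := hsmall s hs (hsn.trans_lt hjε)
  refine ⟨L', hL'U, ?_⟩
  rw [hL']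
  rintro _ ⟨x, hx, rfl⟩
  refine ⟨πa (j x), ?_⟩
  change e (πa (j x)) + κ (s (πa (j x))) = j x
  rw [hsβ (πa (j x)) ⟨x, hx, rfl⟩, hβA]
  exact hdec (j x)

end

/-! ### Lifts and perturbation of kernels -/

theorem LinearMap.exists_lift_of_le_range {V W : Type*} [AddCommGroup V] [Module ℝ V]
    [AddCommGroup W] [Module ℝ W] (r : V →ₗ[ℝ] W) {Q : Submodule ℝ W}
    (hQ : Q ≤ LinearMap.range r) : ∃ s : Q →ₗ[ℝ] V, ∀ q, r (s q) = q := by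
  obtain ⟨s, hs⟩ := r.rangeRestrict.exists_rightInverse_of_surjective r.range_rangeRestrict
  exact ⟨s ∘ₗ Submodule.inclusion hQ, fun q =>
    congrArg Subtype.val (LinearMap.congr_fun hs (Submodule.inclusion hQ q))⟩

theorem LinearMap.finrank_map_of_injective {V W : Type*} [AddCommGroup V] [Module ℝ V]
    [AddCommGroup W] [Module ℝ W] {r : V →ₗ[ℝ] W} (hr : Function.Injective r)
    (p : Submodule ℝ V) : finrank ℝ (p.map r) = finrank ℝ p :=
  (p.equivMapOfInjective r hr).finrank_eq.symm

theorem Filter.Tendsto.clm_comp {ι V₁ V₂ V₃ : Type*} [NormedAddCommGroup V₁] [NormedSpace ℝ V₁]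
    [NormedAddCommGroup V₂] [NormedSpace ℝ V₂] [NormedAddCommGroup V₃] [NormedSpace ℝ V₃]
    {l : Filter ι} {f : ι → V₂ →L[ℝ] V₃} {g : ι → V₁ →L[ℝ] V₂} {f₀ : V₂ →L[ℝ] V₃}
    {g₀ : V₁ →L[ℝ] V₂} (hf : Tendsto f l (𝓝 f₀)) (hg : Tendsto g l (𝓝 g₀)) :
    Tendsto (fun i => f i ∘L g i) l (𝓝 (f₀ ∘L g₀)) :=
  ((continuous_fst.clm_comp continuous_snd).tendsto (f₀, g₀)).comp (hf.prodMk_nhds hg)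

section

variable {E F : Type*} [NormedAddCommGroup E] [NormedSpace ℝ E] [FiniteDimensional ℝ E]
  [NormedAddCommGroup F] [NormedSpace ℝ F] [FiniteDimensional ℝ F]

/-- The kernel of a linear map `T` close to `T₀` is close to a subspace of the kernel of `T₀`. -/
theorem exists_tendsto_one_ker_perturbation (T₀ : E →L[ℝ] F) :
    ∃ G : (E →L[ℝ] F) → E →L[ℝ] E, Tendsto G (𝓝 T₀) (𝓝 1) ∧
      ∀ᶠ T : E →L[ℝ] F in 𝓝 T₀, ∃ P ≤ LinearMap.ker (T₀ : E →ₗ[ℝ] F),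
        finrank ℝ P = finrank ℝ (LinearMap.ker (T : E →ₗ[ℝ] F)) ∧ ∀ x ∈ P, T (G T x) = 0 := by
  obtain ⟨s, hs⟩ := (T₀ : E →ₗ[ℝ] F).rangeRestrict.exists_rightInverse_of_surjective
    (LinearMap.range_rangeRestrict _)
  obtain ⟨S, hS⟩ := LinearMap.exists_extend s
  have hTS : ∀ x, T₀ (S (T₀ x)) = T₀ x := fun x => by
    have h1 : S (T₀ x) = s ((T₀ : E →ₗ[ℝ] F).rangeRestrict x) :=
      LinearMap.congr_fun hS ((T₀ : E →ₗ[ℝ] F).rangeRestrict x)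
    have h2 := congrArg Subtype.val
      (LinearMap.congr_fun hs ((T₀ : E →ₗ[ℝ] F).rangeRestrict x))
    rw [h1]
    exact h2
  -- Since `T₀ S T₀ = T₀`, this invertible map carries `ker T` into `ker T₀`; its inverse is `G T`.
  let A : (E →L[ℝ] F) → E →L[ℝ] E := fun T => 1 + S.toContinuousLinearMap ∘L (T - T₀)
  have hA : Tendsto A (𝓝 T₀) (𝓝 1) := by
    have hc : Continuous A := by fun_prop
    simpa [A] using hc.tendsto T₀
  refine ⟨fun T => Ring.inverse (A T), ?_, ?_⟩
  · have h := (NormedRing.inverse_continuousAt (1 : (E →L[ℝ] E)ˣ)).tendsto.comp hA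
    rwa [Units.val_one, Ring.inverse_one] at h
  · filter_upwards [hA.eventually (Units.isOpen.mem_nhds isUnit_one)] with T hT
    have hinv : ∀ x, Ring.inverse (A T) (A T x) = x := fun x =>
      DFunLike.congr_fun (Ring.inverse_mul_cancel _ hT) x
    refine ⟨(LinearMap.ker (T : E →ₗ[ℝ] F)).map (A T : E →ₗ[ℝ] E), ?_, ?_, ?_⟩
    · rintro _ ⟨x, hx, rfl⟩
      replace hx : T x = 0 := hx
      change T₀ (x + S (T x - T₀ x)) = 0
      rw [hx, zero_sub, map_neg, map_add, map_neg, hTS, add_neg_cancel]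
    · exact LinearMap.finrank_map_of_injective (Function.LeftInverse.injective hinv) _
    · rintro _ ⟨x, hx, rfl⟩
      change T (Ring.inverse (A T) (A T x)) = 0
      rw [hinv]
      exact hx

theorem Submodule.finrank_add_le_finrank_comap_add {V W : Type*} [AddCommGroup V] [Module ℝ V]
    [FiniteDimensional ℝ V] [AddCommGroup W] [Module ℝ W] [FiniteDimensional ℝ W]
    (σ : V →ₗ[ℝ] W) {P K : Submodule ℝ W} (hP : P ≤ K) (hσ : ∀ v, σ v ∈ K) :
    finrank ℝ V + finrank ℝ P ≤ finrank ℝ (P.comap σ) + finrank ℝ K := by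
  have h1 := Submodule.finrank_map_add_finrank_ker_inf σ (P.comap σ)
  have h2 := σ.finrank_range_add_finrank_ker
  have h3 := Submodule.finrank_sup_add_finrank_inf_eq (LinearMap.range σ) P
  have h4 : finrank ℝ ↥(LinearMap.range σ ⊔ P) ≤ finrank ℝ K :=
    Submodule.finrank_mono (sup_le (by rintro _ ⟨v, rfl⟩; exact hσ v) hP)
  rw [Submodule.map_comap_eq, inf_eq_right.2 (LinearMap.ker_le_comap σ)] at h1
  omega

end

/-- The underlying composition of Lagrangian relations. -/
def LagrangianGrassmannian.comp {X Y Z : Type*} [AddCommGroup X] [Module ℝ X] [AddCommGroup Y]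
    [Module ℝ Y] [AddCommGroup Z] [Module ℝ Z] [FiniteDimensional ℝ X] [FiniteDimensional ℝ Y]
    [FiniteDimensional ℝ Z] {ωX : SymplecticForm X} {ωY : SymplecticForm Y}
    {ωZ : SymplecticForm Z} (f : LagrangianGrassmannian (ωX.prod ωY.dual))
    (g : LagrangianGrassmannian (ωY.prod ωZ.dual)) :
    LagrangianGrassmannian (ωX.prod ωZ.dual) :=
  ⟨linRelComp f.1 g.1, isLagrangian_linRelComp f.2 g.2⟩

/-! ### Continuity of the composition along levels -/

section

variable {X Y Z : Type*} [NormedAddCommGroup X] [NormedSpace ℝ X]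
  [NormedAddCommGroup Y] [NormedSpace ℝ Y]
  [NormedAddCommGroup Z] [NormedSpace ℝ Z]

/-- The map `f × g → Y` whose kernel parametrizes the composable pairs. -/
def matching {f : Submodule ℝ (X × Y)} {g : Submodule ℝ (Y × Z)}
    (p : (f →L[ℝ] X × Y) × (g →L[ℝ] Y × Z)) : f × g →L[ℝ] Y :=
  ContinuousLinearMap.snd ℝ X Y ∘L p.1 ∘L ContinuousLinearMap.fst ℝ f g -
    ContinuousLinearMap.fst ℝ Y Z ∘L p.2 ∘L ContinuousLinearMap.snd ℝ f g

/-- The map `f × g → X × Z` to the outer coordinates. -/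
def outerMap {f : Submodule ℝ (X × Y)} {g : Submodule ℝ (Y × Z)}
    (p : (f →L[ℝ] X × Y) × (g →L[ℝ] Y × Z)) : f × g →L[ℝ] X × Z :=
  ContinuousLinearMap.inl ℝ X Z ∘L ContinuousLinearMap.fst ℝ X Y ∘L p.1 ∘L
      ContinuousLinearMap.fst ℝ f g +
    ContinuousLinearMap.inr ℝ X Z ∘L ContinuousLinearMap.snd ℝ Y Z ∘L p.2 ∘L
      ContinuousLinearMap.snd ℝ f g

variable {f : Submodule ℝ (X × Y)} {g : Submodule ℝ (Y × Z)}

theorem matching_eq_zero_iff (p : (f →L[ℝ] X × Y) × (g →L[ℝ] Y × Z)) (x : f × g) :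
    matching p x = 0 ↔ (p.1 x.1).2 = (p.2 x.2).1 :=
  sub_eq_zero

theorem outerMap_apply (p : (f →L[ℝ] X × Y) × (g →L[ℝ] Y × Z)) (x : f × g) :
    outerMap p x = ((p.1 x.1).1, (p.2 x.2).2) := by
  simp [outerMap]

theorem continuous_matching :
    Continuous (matching : (f →L[ℝ] X × Y) × (g →L[ℝ] Y × Z) → f × g →L[ℝ] Y) := by
  unfold matching
  have h₁ : Continuous fun p : (f →L[ℝ] X × Y) × (g →L[ℝ] Y × Z) => p.1 := continuous_fst
  have h₂ : Continuous fun p : (f →L[ℝ] X × Y) × (g →L[ℝ] Y × Z) => p.2 := continuous_snd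
  exact (continuous_const.clm_comp (h₁.clm_comp continuous_const)).sub
    (continuous_const.clm_comp (h₂.clm_comp continuous_const))

theorem continuous_outerMap :
    Continuous (outerMap : (f →L[ℝ] X × Y) × (g →L[ℝ] Y × Z) → f × g →L[ℝ] X × Z) := by
  unfold outerMap
  have h₁ : Continuous fun p : (f →L[ℝ] X × Y) × (g →L[ℝ] Y × Z) => p.1 := continuous_fst
  have h₂ : Continuous fun p : (f →L[ℝ] X × Y) × (g →L[ℝ] Y × Z) => p.2 := continuous_snd
  exact (continuous_const.clm_comp (continuous_const.clm_comp (h₁.clm_comp continuous_const))).add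
    (continuous_const.clm_comp (continuous_const.clm_comp (h₂.clm_comp continuous_const)))

/-- Links the kernel of `matching` to the intersection with `C` that enters the excess formula. -/
theorem map_ker_matching (p : (f →L[ℝ] X × Y) × (g →L[ℝ] Y × Z)) :
    (LinearMap.ker (matching p : f × g →ₗ[ℝ] Y)).map
        ((p.1 : f →ₗ[ℝ] X × Y).prodMap (p.2 : g →ₗ[ℝ] Y × Z)) =
      (LinearMap.range (p.1 : f →ₗ[ℝ] X × Y)).prod (LinearMap.range (p.2 : g →ₗ[ℝ] Y × Z)) ⊓
        diagonalCoisotropic X Y Z := by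
  ext w
  constructor
  · rintro ⟨x, hx, rfl⟩
    exact ⟨⟨⟨x.1, rfl⟩, ⟨x.2, rfl⟩⟩, (matching_eq_zero_iff p x).1 hx⟩
  · rintro ⟨⟨⟨u, hu⟩, ⟨v, hv⟩⟩, hw : w.1.2 = w.2.1⟩
    refine ⟨(u, v), (matching_eq_zero_iff p (u, v)).2 ?_, Prod.ext hu hv⟩
    rw [← hu, ← hv] at hw
    exact hw

theorem outerMap_mem_linRelComp {p : (f →L[ℝ] X × Y) × (g →L[ℝ] Y × Z)} {x : f × g}
    (hx : matching p x = 0) :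
    outerMap p x ∈ linRelComp (LinearMap.range (p.1 : f →ₗ[ℝ] X × Y))
      (LinearMap.range (p.2 : g →ₗ[ℝ] Y × Z)) := by
  rw [outerMap_apply]
  refine ⟨(p.1 x.1).2, ⟨x.1, rfl⟩, ⟨x.2, ?_⟩⟩
  rw [(matching_eq_zero_iff p x).1 hx]
  rfl

theorem exists_lift_linRelComp {Q : Submodule ℝ (X × Z)} (hQ : Q ≤ linRelComp f g) :
    ∃ σ : Q →ₗ[ℝ] f × g, ∀ q, matching (f.subtypeL, g.subtypeL) (σ q) = 0 ∧
      outerMap (f.subtypeL, g.subtypeL) (σ q) = q := by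
  obtain ⟨K, hK⟩ : ∃ K : Submodule ℝ (f × g), ∀ x, x ∈ K ↔
      matching (f.subtypeL, g.subtypeL) x = 0 :=
    ⟨LinearMap.ker (matching (f.subtypeL, g.subtypeL) : f × g →ₗ[ℝ] Y), fun _ => Iff.rfl⟩
  obtain ⟨r, hr⟩ : ∃ r : K →ₗ[ℝ] X × Z, ∀ x : K,
      r x = outerMap (f.subtypeL, g.subtypeL) (x : f × g) :=
    ⟨(outerMap (f.subtypeL, g.subtypeL) : f × g →ₗ[ℝ] X × Z) ∘ₗ K.subtype, fun _ => rfl⟩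
  have hQr : Q ≤ LinearMap.range r := by
    intro q hq
    obtain ⟨y, hy, hy'⟩ := hQ hq
    let x : f × g := (⟨(q.1, y), hy⟩, ⟨(y, q.2), hy'⟩)
    exact ⟨⟨x, (hK x).2 ((matching_eq_zero_iff _ x).2 rfl)⟩,
      (hr _).trans (outerMap_apply _ x)⟩
  obtain ⟨s, hs⟩ : ∃ s : Q →ₗ[ℝ] K, ∀ q, r (s q) = q :=
    LinearMap.exists_lift_of_le_range (V := K) (W := X × Z) r hQr
  exact ⟨K.subtype ∘ₗ s, fun q => ⟨(hK _).1 (s q).2, (hr _).symm.trans (hs q)⟩⟩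

variable [FiniteDimensional ℝ X] [FiniteDimensional ℝ Y] [FiniteDimensional ℝ Z]
  {ωX : SymplecticForm X} {ωY : SymplecticForm Y} {ωZ : SymplecticForm Z}

theorem image_range_mem_nhds_lagrangian {W : Type*} [NormedAddCommGroup W] [NormedSpace ℝ W]
    [FiniteDimensional ℝ W] {ω : SymplecticForm W} (L : LagrangianGrassmannian ω)
    {N : Set (L.1 →L[ℝ] W)} (hN : N ∈ 𝓝 L.1.subtypeL) :
    {L' : LagrangianGrassmannian ω | ∃ φ ∈ N, LinearMap.range (φ : L.1 →ₗ[ℝ] W) = L'.1} ∈ 𝓝 L := by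
  refine (@mem_nhds_induced _ _ (grassmannianTopology W) _ _ _).2
    ⟨(fun φ : L.1 →L[ℝ] W => LinearMap.range (φ : L.1 →ₗ[ℝ] W)) '' N, ?_, fun _ h => h⟩
  have h := image_range_mem_nhds_grassmannian _ hN
  rwa [show LinearMap.range (L.1.subtypeL : L.1 →ₗ[ℝ] W) = L.1 from L.1.range_subtype] at h

/-- Continuity of the composition along the levels: if the composition jumps as `f` and `g` are
perturbed, the jump is accounted for by the drop of the excess. -/
theorem LagrangianGrassmannian.exists_nhds_comp (f : LagrangianGrassmannian (ωX.prod ωY.dual))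
    (g : LagrangianGrassmannian (ωY.prod ωZ.dual)) (L : LagrangianGrassmannian (ωX.prod ωZ.dual))
    {U : Set (LagrangianGrassmannian (ωX.prod ωZ.dual))} (hU : U ∈ 𝓝 L) :
    ∃ V₁ ∈ 𝓝 f, ∃ V₂ ∈ 𝓝 g, ∀ f' ∈ V₁, ∀ g' ∈ V₂, ∃ L' ∈ U,
      lagrangianDist L' (f'.comp g') +
        ((ωX.prod ωY.dual).prod (ωY.prod ωZ.dual)).excess (diagonalCoisotropic X Y Z)
          (f'.1.prod g'.1) ≤
      lagrangianDist L (f.comp g) +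
        ((ωX.prod ωY.dual).prod (ωY.prod ωZ.dual)).excess (diagonalCoisotropic X Y Z)
          (f.1.prod g.1) := by
  let p₀ := (f.1.subtypeL, g.1.subtypeL)
  let Q := L.1 ⊓ (f.comp g).1
  obtain ⟨σ, hσ⟩ := exists_lift_linRelComp (inf_le_right : Q ≤ linRelComp f.1 g.1)
  obtain ⟨G, hG, hGker⟩ := exists_tendsto_one_ker_perturbation (matching p₀)
  let j : (f.1 →L[ℝ] X × Y) × (g.1 →L[ℝ] Y × Z) → Q →L[ℝ] X × Z := fun p =>
    outerMap p ∘L G (matching p) ∘L σ.toContinuousLinearMap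
  have hm : Tendsto matching (𝓝 p₀) (𝓝 (matching p₀)) := continuous_matching.tendsto _
  have hj : Tendsto j (𝓝 p₀) (𝓝 Q.subtypeL) := by
    have ho : Tendsto outerMap (𝓝 p₀) (𝓝 (outerMap p₀)) := continuous_outerMap.tendsto p₀
    have h := ho.clm_comp
      ((hG.comp hm).clm_comp (tendsto_const_nhds (x := σ.toContinuousLinearMap)))
    have h0 : outerMap p₀ ∘L (1 : f.1 × g.1 →L[ℝ] f.1 × g.1) ∘L σ.toContinuousLinearMap =
        Q.subtypeL := ContinuousLinearMap.ext fun q => (hσ q).2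
    rwa [h0] at h
  have hinj : ∀ᶠ p in 𝓝 p₀, Function.Injective (j p) :=
    hj.eventually (ContinuousLinearMap.isOpen_injective.mem_nhds Q.injective_subtype)
  have hlag := hj.eventually
    (eventually_exists_lagrangian_ge L hU (inf_le_left : Q ≤ L.1))
  obtain ⟨N₁, hN₁, N₂, hN₂, hN⟩ := mem_nhds_prod_iff.1
    (((hm.eventually hGker).and hinj).and hlag)
  refine ⟨_, image_range_mem_nhds_lagrangian f hN₁, _, image_range_mem_nhds_lagrangian g hN₂, ?_⟩
  rintro f' ⟨φ, hφ, hf'⟩ g' ⟨ψ, hψ, hg'⟩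
  obtain ⟨⟨⟨P, hP, hPr, hPG⟩, hji⟩, hL⟩ := hN (Set.mk_mem_prod hφ hψ)
  have hmem : ∀ q ∈ P.comap σ, j (φ, ψ) q ∈ (f'.comp g').1 := fun q hq => by
    have h := outerMap_mem_linRelComp (hPG _ hq)
    rw [hf', hg'] at h
    exact h
  -- The subspace `P.comap σ` depends on the perturbation, so closeness must be uniform in `Q'`
  -- here.
  obtain ⟨L', hL'U, hL'⟩ := hL (P.comap σ) fun x hx y hy =>
    (f'.comp g').2.form_eq_zero (hmem x hx) (hmem y hy)
  refine ⟨L', hL'U, ?_⟩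
  have r₁ : finrank ℝ (P.comap σ) ≤ finrank ℝ ↥(L'.1 ⊓ (f'.comp g').1) := by
    rw [← LinearMap.finrank_map_of_injective hji]
    refine Submodule.finrank_mono (le_inf hL' ?_)
    rintro _ ⟨q, hq, rfl⟩
    exact hmem q hq
  have r₂ := Submodule.finrank_add_le_finrank_comap_add σ hP fun q => (hσ q).1
  -- An inequality suffices, so `φ` and `ψ` need not be injective: `dim P` is at least `dim ((f' ×
  -- g') ∩ C)`.
  have r₃ := Submodule.finrank_map_le
    ((φ : f.1 →ₗ[ℝ] X × Y).prodMap (ψ : g.1 →ₗ[ℝ] Y × Z))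
    (LinearMap.ker (matching (φ, ψ) : f.1 × g.1 →ₗ[ℝ] Y))
  rw [map_ker_matching (φ, ψ), hf', hg'] at r₃
  have r₄ : finrank ℝ (LinearMap.ker (matching p₀ : f.1 × g.1 →ₗ[ℝ] Y)) =
      finrank ℝ ↥(f.1.prod g.1 ⊓ diagonalCoisotropic X Y Z) := by
    have h := LinearMap.finrank_map_of_injective (r := f.1.subtype.prodMap g.1.subtype)
      (Function.Injective.prodMap f.1.injective_subtype g.1.injective_subtype)
      (LinearMap.ker (matching p₀ : f.1 × g.1 →ₗ[ℝ] Y))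
    have h' := map_ker_matching p₀
    rw [show LinearMap.range (p₀.1 : f.1 →ₗ[ℝ] X × Y) = f.1 from f.1.range_subtype,
      show LinearMap.range (p₀.2 : g.1 →ₗ[ℝ] Y × Z) = g.1 from g.1.range_subtype] at h'
    rw [← h', ← h]
    rfl
  have c₁ := finrank_linRelComp_add_excess ωX ωY ωZ f.1 g.1
  have c₂ := finrank_linRelComp_add_excess ωX ωY ωZ f'.1 g'.1
  have d₁ := lagrangianDist_add_finrank_inf L (f.comp g)
  have d₂ := lagrangianDist_add_finrank_inf L' (f'.comp g')
  have l₁ := L.2.two_mul_finrank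
  have l₂ := L'.2.two_mul_finrank
  have l₃ : 2 * finrank ℝ (linRelComp f.1 g.1) = _ := (f.comp g).2.two_mul_finrank
  have l₄ : 2 * finrank ℝ (linRelComp f'.1 g'.1) = _ := (f'.comp g').2.two_mul_finrank
  omega

end

/-! ### Passage to arbitrary spaces and conclusion -/

section

variable {X Y Z : Type*} [AddCommGroup X] [Module ℝ X] [FiniteDimensional ℝ X]
  [AddCommGroup Y] [Module ℝ Y] [FiniteDimensional ℝ Y]
  [AddCommGroup Z] [Module ℝ Z] [FiniteDimensional ℝ Z]

/-- The Grassmannian topology is defined without a norm, so norms pulled back from coordinates may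
be used. -/
theorem IndexedLagrangian.exists_nhds_comp {ωX : SymplecticForm X} {ωY : SymplecticForm Y}
    {ωZ : SymplecticForm Z} (f : LagrangianGrassmannian (ωX.prod ωY.dual))
    (g : LagrangianGrassmannian (ωY.prod ωZ.dual)) (L : LagrangianGrassmannian (ωX.prod ωZ.dual))
    {U : Set (LagrangianGrassmannian (ωX.prod ωZ.dual))} (hU : U ∈ 𝓝 L) :
    ∃ V₁ ∈ 𝓝 f, ∃ V₂ ∈ 𝓝 g, ∀ f' ∈ V₁, ∀ g' ∈ V₂, ∃ L' ∈ U,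
      lagrangianDist L' (f'.comp g') +
        ((ωX.prod ωY.dual).prod (ωY.prod ωZ.dual)).excess (diagonalCoisotropic X Y Z)
          (f'.1.prod g'.1) ≤
      lagrangianDist L (f.comp g) +
        ((ωX.prod ωY.dual).prod (ωY.prod ωZ.dual)).excess (diagonalCoisotropic X Y Z)
          (f.1.prod g.1) := by
  let eX := (finBasis ℝ X).equivFun
  let eY := (finBasis ℝ Y).equivFun
  let eZ := (finBasis ℝ Z).equivFun
  let _ := NormedAddCommGroup.induced X _ eX eX.injective
  let _ := NormedAddCommGroup.induced Y _ eY eY.injective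
  let _ := NormedAddCommGroup.induced Z _ eZ eZ.injective
  let _ := NormedSpace.induced ℝ X _ eX
  let _ := NormedSpace.induced ℝ Y _ eY
  let _ := NormedSpace.induced ℝ Z _ eZ
  exact LagrangianGrassmannian.exists_nhds_comp f g L hU

end

theorem IndexedLagrangian.sublevelSet_mem_nhds {X : Type*} [AddCommGroup X] [Module ℝ X]
    [FiniteDimensional ℝ X]
    {ω : SymplecticForm X} (a : IndexedLagrangian ω) {V : Set (LagrangianGrassmannian ω)}
    (hV : V ∈ 𝓝 a.space) : IndexedLagrangian.sublevelSet V a.index ∈ 𝓝 a := by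
  obtain ⟨O, hOV, hO, haO⟩ := mem_nhds_iff.1 hV
  refine mem_nhds_iff.2 ⟨IndexedLagrangian.sublevelSet O a.index,
    Set.biUnion_subset_biUnion_left hOV, TopologicalSpace.isOpen_generateFrom_of_mem
      ⟨O, a.index, hO, rfl⟩, Set.mem_iUnion₂.2 ⟨a.space, haO, ?_⟩⟩
  have h : lagrangianDist a.space a.space = 0 := by
    have h := lagrangianDist_add_finrank_inf a.space a.space
    rw [inf_idem] at h
    omega
  simp [IndexedLagrangian.sublevel, h]

theorem mainTheorem10 {X Y Z : Type*}
    [AddCommGroup X] [Module ℝ X] [FiniteDimensional ℝ X]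
    [AddCommGroup Y] [Module ℝ Y] [FiniteDimensional ℝ Y]
    [AddCommGroup Z] [Module ℝ Z] [FiniteDimensional ℝ Z]
    (ωX : SymplecticForm X) (ωY : SymplecticForm Y) (ωZ : SymplecticForm Z) :
    Continuous (fun p : IndexedLagrangian (ωX.prod ωY.dual) ×
        IndexedLagrangian (ωY.prod ωZ.dual) =>
      (p.1.comp p.2 : IndexedLagrangian (ωX.prod ωZ.dual))) := by
  refine continuous_generateFrom_iff.2 ?_
  rintro _ ⟨U, m, hU, rfl⟩
  rw [isOpen_iff_mem_nhds]
  rintro ⟨a, b⟩ hab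
  obtain ⟨L, hLU, hL⟩ := Set.mem_iUnion₂.1 hab
  replace hL : (lagrangianDist L (a.space.comp b.space) : ℤ) ≤ m - (a.comp b).index := hL
  obtain ⟨V₁, hV₁, V₂, hV₂, hV⟩ :=
    IndexedLagrangian.exists_nhds_comp a.space b.space L (hU.mem_nhds hLU)
  filter_upwards [prod_mem_nhds (a.sublevelSet_mem_nhds hV₁) (b.sublevelSet_mem_nhds hV₂)]
  rintro ⟨a', b'⟩ ⟨ha', hb'⟩
  obtain ⟨f, hf, ha'⟩ := Set.mem_iUnion₂.1 ha'
  obtain ⟨g, hg, hb'⟩ := Set.mem_iUnion₂.1 hb'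
  obtain ⟨L', hL'U, hL'⟩ := hV f hf g hg
  -- `f` and `g` witness that `a'` and `b'` lie below points of the levels of `a` and `b`.
  -- Monotonicity compares the composite of `a'` and `b'` with that of those points, which lies
  -- below `L'`.
  have hmono : (lagrangianDist (f.comp g) (a'.space.comp b'.space) : ℤ) ≤
      ((IndexedLagrangian.comp ⟨f, a.index⟩ ⟨g, b.index⟩).index : ℤ) - (a'.comp b').index :=
    IndexedLagrangian.comp_mem_sublevel ha' hb'
  have htri := lagrangianDist_triangle L' (f.comp g) (a'.space.comp b'.space)
  refine Set.mem_iUnion₂.2 ⟨L', hL'U, ?_⟩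
  change (lagrangianDist L' (a'.space.comp b'.space) : ℤ) ≤ m - (a'.comp b').index
  have i₁ : (a.comp b).index = a.index + b.index + SymplecticForm.excess _ _ _ := rfl
  have i₂ : (IndexedLagrangian.comp ⟨f, a.index⟩ ⟨g, b.index⟩).index =
    a.index + b.index + SymplecticForm.excess _ _ (f.1.prod g.1) := rfl
  omega
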